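/- **Notation.** For $S\subset\mathbb R^D$ and $x\in\mathbb R^D$ let $d_S(x)=\inf_{y\in S}\|x-y\|$ and $\pi_S(x)=\{y\in S:\|x-y\|=d_S(x)\}$. For a nonempty bounded set $\sigma$ let $m(\sigma)$ be the center of its smallest enclosing closed ball. If $x\notin S$ and $\pi_S(x)\neq\emptyset$, let $\nabla d_S(x)=(x-m(\pi_S(x)))/d_S(x)$. For $\mu\ge 0$ let $Z_\mu(S)$ be the set of $z\notin S$ with $\pi_S(z)\ne\emptyset$ and $\|\nabla d_S(z)\|\le\mu$, and let $Z(S)=Z_0(S)$ be the set of critical points of $S$. $B(x,r)$ is the open ball and $d_H$ the Hausdorff distance (infinite between the empty set and a nonempty set). For $\delta>0$ and $\varepsilon\in(0,\infty]$, a $(\delta,\varepsilon)$-sampling of $S$ is a finite set $A\subset S$ with $d_H(A,S)\le\varepsilon$ and $\|x-y\|\ge\delta$ for all distinct $x,y\in A$. For $M\subset\mathbb R^D$ compact and $\delta,r>0$, the packing number $N(\delta,r)$ of $M$ is the maximal cardinality of a $(\delta,\infty)$-sampling of a set $B(x,r)\cap M$ with $x\in M$ (and $0$ if $M=\emptyset$).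 Consider the following conditions on a compact $C^2$ submanifold $M\subset\mathbb R^D$ (without boundary). * (P1) For every $z\in Z(M)$, the points of $\pi_M(z)$ are affinely independent and $z$ lies in the relative interior of their convex hull. * (P2) $Z(M)$ is finite. * (P3) For all $z\in Z(M)$ and $x\in\pi_M(z)$ there are $\rho,\alpha>0$ with $\|y-z\|^2\ge\|x-z\|^2+\alpha\|y-x\|^2$ for all $y\in M\cap B(x,\rho)$. * (P4) There are $C>0$ and $\mu_0\in(0,1)$ such that for all $\mu\in[0,\mu_0)$ every point of $Z_\mu(M)$ is at distance at most $C\mu$ from some point of $Z(M)$. Call $(C_1,\dots,C_5,\varepsilon_0)$ *stability constants* of $M$ if they are positive and the following holds for all $0<\varepsilon\le\varepsilon_0$, all $A\subset M$ with $d_H(A,M)\le\varepsilon$ and all $z\in Z(A)$: 1. exactly one of these two cases occurs: (a) $d_M(z)\le C_1\varepsilon^2$; (b) there is $w\in Z_{C_3\varepsilon}(M)$ with $\|z-w\|\le C_2\varepsilon$; 2. if $M$ satisfies (P4), then in case (b) there is $z'\in Z(M)$ with $\|z-z'\|\le C_4\varepsilon$; 3. if $M$ satisfies (P1)–(P4),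 then in case (b) there is $z'\in Z(M)$ with $\|z-z'\|\le C_4\varepsilon$ such that every point of $\pi_A(z)$ is at distance less than $C_5\varepsilon$ from $\pi_M(z')$. **Statement.** For every integer $m\ge 0$ there is a constant $C_m>0$, depending only on $m$, such that the following holds for every $D$ and every compact $C^2$ submanifold $M\subset\mathbb R^D$ of dimension $m$ satisfying (P1)–(P4). There exist stability constants $(C_1,\dots,C_5,\varepsilon_0)$ of $M$ and $\varepsilon_1>0$ such that, for all $0<\delta\le\varepsilon\le\varepsilon_1$: * for every $(\delta,\varepsilon)$-sampling $A$ of $M$ and every $z\in Z(M)$, with $s$ the cardinality of $\pi_M(z)$, the number of points of $Z(A)$ at distance less than $C_4\varepsilon$ from $z$ is finite and at most $2^{N(\delta,C_5\varepsilon)\,s}$; * $N(\delta,C_5\varepsilon)\le\left(\dfrac{C_m C_5\,\varepsilon}{\delta}\right)^{m}$. -/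

import Mathlib

open scoped ENNReal

namespace CritDist

section General

variable {E : Type*} [NormedAddCommGroup E] [NormedSpace ℝ E]

/-- The set `π_S(x)` of all projections of `x` on `S`. -/
def proj (S : Set E) (x : E) : Set E :=
  {y | y ∈ S ∧ Metric.infDist x S = dist x y}

/-- `c` is the center of a smallest closed ball enclosing `σ`. -/
def IsMinEnclosingCenter (σ : Set E) (c : E) : Prop :=
  ∃ r : ℝ, σ ⊆ Metric.closedBall c r ∧
    ∀ (c' : E) (r' : ℝ), σ ⊆ Metric.closedBall c' r' → r ≤ r'

/-- The center `m(σ)` of the smallest enclosing ball of a nonempty bounded set `σ`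
(existence and uniqueness in Euclidean space: `existsUnique_isMinEnclosingCenter`). -/
noncomputable def enclosingCenter (σ : Set E) : E :=
  Classical.epsilon (IsMinEnclosingCenter σ)

open Classical in
/-- The generalized gradient of the distance function to `S`: it is
`(x - m(π_S(x))) / d_S(x)` for `x ∉ S` and `0` on `S`. -/
noncomputable def gradDist (S : Set E) (x : E) : E :=
  if x ∈ S then 0 else (Metric.infDist x S)⁻¹ • (x - enclosingCenter (proj S x))

/-- The `μ`-critical points of `S`: points `z ∉ S` where the generalized gradient has norm
at most `μ`. The gradient only makes sense if `z` has a projection on `S`, which is automatic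
when `S` is compact and nonempty. -/
def muCriticalPoints (S : Set E) (μ : ℝ) : Set E :=
  {z | z ∉ S ∧ (proj S z).Nonempty ∧ ‖gradDist S z‖ ≤ μ}

/-- The critical points `Z(S)` of the distance function to `S`. -/
def criticalPoints (S : Set E) : Set E :=
  {z | z ∉ S ∧ (proj S z).Nonempty ∧ gradDist S z = 0}

/-- The projections of a critical point are the vertices of a nondegenerate simplex, and the
critical point lies in the relative interior of their convex hull. -/
def P1 (M : Set E) : Prop :=
  ∀ z ∈ criticalPoints M,
    AffineIndependent ℝ (fun x : proj M z => (x : E)) ∧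
      z ∈ intrinsicInterior ℝ (convexHull ℝ (proj M z))

/-- There are finitely many critical points. -/
def P2 (M : Set E) : Prop := (criticalPoints M).Finite

/-- The spheres centered at the critical points are non-osculating at the projections. -/
def P3 (M : Set E) : Prop :=
  ∀ z ∈ criticalPoints M, ∀ x ∈ proj M z, ∃ δ : ℝ, 0 < δ ∧ ∃ α : ℝ, 0 < α ∧
    ∀ y ∈ M ∩ Metric.ball x δ, ‖x - z‖ ^ 2 + α * ‖y - x‖ ^ 2 ≤ ‖y - z‖ ^ 2

/-- For small `μ`, every `μ`-critical point is within distance `C μ` of a critical point. -/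
def P4 (M : Set E) : Prop :=
  ∃ C : ℝ, 0 < C ∧ ∃ μ₀ : ℝ, 0 < μ₀ ∧ μ₀ < 1 ∧
    ∀ μ : ℝ, 0 ≤ μ → μ < μ₀ → ∀ w ∈ muCriticalPoints M μ,
      ∃ z ∈ criticalPoints M, dist w z ≤ C * μ

/-- `A` is a `(δ, ε)`-sampling of `S`, where `ε = ∞` is allowed: `A` is a finite subset of `S`
at Hausdorff distance at most `ε` from `S` (this extended distance is `∞` between `∅` and a
nonempty set), and distinct points of `A` are at distance at least `δ`. -/
def IsSampling (δ : ℝ) (ε : ℝ≥0∞) (S A : Set E) : Prop :=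
  A.Finite ∧ A ⊆ S ∧ Metric.hausdorffEDist A S ≤ ε ∧
    ∀ x ∈ A, ∀ y ∈ A, x ≠ y → δ ≤ ‖x - y‖

/-- The cardinalities of the `(δ, ∞)`-samplings of the sets `B(x, r) ∩ M` with `x ∈ M`. -/
def packingCards (M : Set E) (δ r : ℝ) : Set ℕ :=
  {n | ∃ x ∈ M, ∃ A : Set E, IsSampling δ ⊤ (Metric.ball x r ∩ M) A ∧ A.ncard = n}

/-- The packing number `N(δ, r)` of `M`: the largest element of `packingCards M δ r`. (This set
is bounded above when `M` is compact and `δ > 0`, see `bddAbove_packingCards`.) -/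
noncomputable def packingNumber (M : Set E) (δ r : ℝ) : ℕ := sSup (packingCards M δ r)

/-- `C₁, …, C₅` and `ε₀` are constants for which the stability of the critical points of `M` and
of their projections with respect to taking subsets `A ⊆ M` with `d_H(A, M) ≤ ε ≤ ε₀` holds. -/
structure IsStabilityConstants (M : Set E) (C₁ C₂ C₃ C₄ C₅ ε₀ : ℝ) : Prop where
  pos₁ : 0 < C₁
  pos₂ : 0 < C₂
  pos₃ : 0 < C₃
  pos₄ : 0 < C₄
  pos₅ : 0 < C₅
  pos_ε₀ : 0 < ε₀
  /-- Exactly one holds: `z` is within `C₁ ε²` of `M`, or it is within `C₂ ε` of a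
  `C₃ ε`-critical point of `M`. -/
  dichotomy : ∀ (ε : ℝ) (A : Set E), 0 < ε → ε ≤ ε₀ → A ⊆ M →
    Metric.hausdorffEDist A M ≤ ENNReal.ofReal ε → ∀ z ∈ criticalPoints A,
      Xor (Metric.infDist z M ≤ C₁ * ε ^ 2)
        (∃ w ∈ muCriticalPoints M (C₃ * ε), dist z w ≤ C₂ * ε)
  /-- Under (P4), in the second case, `z` is within `C₄ ε` of a critical point of `M`. -/
  near_critical : P4 M → ∀ (ε : ℝ) (A : Set E), 0 < ε → ε ≤ ε₀ → A ⊆ M →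
    Metric.hausdorffEDist A M ≤ ENNReal.ofReal ε → ∀ z ∈ criticalPoints A,
      (∃ w ∈ muCriticalPoints M (C₃ * ε), dist z w ≤ C₂ * ε) →
        ∃ z' ∈ criticalPoints M, dist z z' ≤ C₄ * ε
  /-- Under (P1)-(P4), in the second case, the projections of `z` on `A` are in the
  `C₅ ε`-neighborhood of the projections on `M` of a critical point of `M` near `z`. -/
  near_proj : P1 M → P2 M → P3 M → P4 M →
    ∀ (ε : ℝ) (A : Set E), 0 < ε → ε ≤ ε₀ → A ⊆ M →
    Metric.hausdorffEDist A M ≤ ENNReal.ofReal ε → ∀ z ∈ criticalPoints A,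
      (∃ w ∈ muCriticalPoints M (C₃ * ε), dist z w ≤ C₂ * ε) →
        ∃ z' ∈ criticalPoints M, dist z z' ≤ C₄ * ε ∧
          proj A z ⊆ Metric.thickening (C₅ * ε) (proj M z')

/-- `M` is an `m`-dimensional `C²` submanifold (without boundary): around each of its points it
is the homeomorphic image of an open subset of `ℝᵐ` under a `C²` immersion. -/
def IsC2Submanifold (m : ℕ) (M : Set E) : Prop :=
  ∀ x ∈ M, ∃ (U : Set (EuclideanSpace ℝ (Fin m))) (V : Set E)
    (φ : EuclideanSpace ℝ (Fin m) → E),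
    IsOpen U ∧ IsOpen V ∧ x ∈ V ∧ ContDiffOn ℝ 2 φ U ∧
      (∀ u ∈ U, Function.Injective (fderiv ℝ φ u)) ∧
      φ '' U = M ∩ V ∧ Topology.IsEmbedding (fun u : U => φ u)

end General

theorem bddAbove_packingCards {E : Type*} [NormedAddCommGroup E] {M : Set E}
    (hM : IsCompact M) {δ : ℝ} (hδ : 0 < δ) (r : ℝ) :
    BddAbove (packingCards M δ r) := by
  obtain ⟨t, -, ht, hcov⟩ := hM.finite_cover_balls (half_pos hδ)
  refine ⟨t.ncard, ?_⟩
  rintro n ⟨x, -, A, ⟨-, hAM, -, hsep⟩, rfl⟩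
  have h : ∀ a ∈ A, ∃ c ∈ t, dist a c < δ / 2 := by
    intro a ha
    have := hcov (hAM ha).2
    simpa using this
  choose! f hft hfd using h
  refine Set.ncard_le_ncard_of_injOn f hft ?_ ht
  intro a ha b hb hab
  by_contra hne
  have h1 := hsep a ha b hb hne
  have h2 := hfd a ha
  have h3 := hfd b hb
  rw [← hab] at h3
  have h4 := dist_triangle_right a b (f a)
  rw [dist_eq_norm a b] at h4
  linarith

theorem existsUnique_isMinEnclosingCenter {D : ℕ} {σ : Set (EuclideanSpace ℝ (Fin D))}
    (hne : σ.Nonempty) (hb : Bornology.IsBounded σ) : ∃! c, IsMinEnclosingCenter σ c := by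
  obtain ⟨y₀, hy₀⟩ := hne
  have : Nonempty σ := ⟨⟨y₀, hy₀⟩⟩
  let f : EuclideanSpace ℝ (Fin D) → ℝ := fun c => ⨆ y : σ, dist (y : EuclideanSpace ℝ (Fin D)) c
  have hbdd : ∀ c, BddAbove (Set.range fun y : σ => dist (y : EuclideanSpace ℝ (Fin D)) c) := by
    intro c
    obtain ⟨R, hR⟩ := hb.subset_closedBall c
    exact ⟨R, by rintro _ ⟨y, rfl⟩; exact hR y.2⟩
  have hle : ∀ c, ∀ y ∈ σ, dist y c ≤ f c := fun c y hy => le_ciSup (hbdd c) ⟨y, hy⟩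
  have hlip : LipschitzWith 1 f := by
    refine LipschitzWith.of_le_add fun c c' => ciSup_le fun y => ?_
    have h1 := hle c' y y.2
    have h2 := dist_triangle_right (y : EuclideanSpace ℝ (Fin D)) c c'
    linarith
  have hlim : Filter.Tendsto f (Filter.cocompact _) Filter.atTop :=
    Filter.tendsto_atTop_mono (fun c => hle c y₀ hy₀) (tendsto_dist_left_cocompact_atTop y₀)
  obtain ⟨c, hc⟩ := hlip.continuous.exists_forall_le hlim
  have hmin : ∀ c' r', σ ⊆ Metric.closedBall c' r' → f c ≤ r' := fun c' r' h =>
    (hc c').trans (ciSup_le fun y => h y.2)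
  refine ⟨c, ⟨f c, fun y hy => hle c y hy, hmin⟩, ?_⟩
  rintro c' ⟨r', hr', hr'min⟩
  have hr : r' = f c := le_antisymm (hr'min c _ fun y hy => hle c y hy) (hmin c' r' hr')
  subst hr
  by_contra hne
  have hd : 0 < ‖c' - c‖ := norm_pos_iff.2 (sub_ne_zero.2 hne)
  have hpos : 0 ≤ f c := dist_nonneg.trans (hle c y₀ hy₀)
  have hkey : σ ⊆ Metric.closedBall (midpoint ℝ c' c) (√(f c ^ 2 - ‖c' - c‖ ^ 2 / 4)) := by
    intro y hy
    have h1 : ‖y - c'‖ ≤ f c := by simpa [dist_eq_norm] using hr' hy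
    have h2 : ‖y - c‖ ≤ f c := by simpa [dist_eq_norm] using hle c y hy
    have h3 := parallelogram_law_with_norm ℝ (y - c') (y - c)
    have h4 : (y - c') + (y - c) = (2 : ℝ) • (y - midpoint ℝ c' c) := by
      rw [midpoint_eq_smul_add, smul_sub, smul_smul, two_smul]
      norm_num
      abel
    have h5 : (y - c') - (y - c) = -(c' - c) := by abel
    rw [h4, h5, norm_neg, norm_smul, Real.norm_ofNat] at h3
    rw [Metric.mem_closedBall, dist_eq_norm]
    apply Real.le_sqrt_of_sq_le
    nlinarith [norm_nonneg (y - c'), norm_nonneg (y - c)]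
  have h6 := hmin _ _ hkey
  have h7 : √(f c ^ 2 - ‖c' - c‖ ^ 2 / 4) < f c := by
    by_cases h0 : f c = 0
    · exfalso
      have e1 := hr' hy₀
      have e2 := hle c y₀ hy₀
      rw [h0] at e1 e2
      have e3 : y₀ = c' := by simpa using e1
      have e4 : y₀ = c := dist_le_zero.1 e2
      exact hne (e3.symm.trans e4)
    · rw [Real.sqrt_lt' (lt_of_le_of_ne hpos (Ne.symm h0))]
      nlinarith
  linarith

end CritDist

/-!
The main tool is the bound `|⟪z - x, y - x⟫| ≤ K ‖z - x‖ ‖y - x‖²` for `x ∈ π_M(z)` and `y ∈ M`,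
which holds with a uniform `K` because `M` is compact and `C²`
(`CritDist.exists_normalQuadraticBound`). It implies that projections are unique near `M`, and
that a sample `A` of `M` at scale `ε` satisfies `d_M² ≤ d_A² ≤ d_M² + O(ε²)`.

Let `z` be a critical point of `A`. Since `z` is the center of the smallest ball enclosing
`π_A(z)`, it lies in the closed convex hull of `π_A(z)`, so `d_A(x)² ≤ d_A(z)² + ‖x - z‖²` for
all `x`. A maximizer `w` of `d_M² - 2‖· - z‖²` is therefore within `O(ε)` of `z`. Its first-order
condition says that `2z - w` is in the closed convex hull of `π_M(w)`
(`CritDist.exists_two_smul_sub_mem_closure_convexHull`). Hence the generalized gradient at `w`,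
which is governed by the point of this hull nearest to `w`, has norm at most
`2‖w - z‖ / d_M(w)`. Away from `M` this makes `w` an `O(ε)`-critical point. Near `M` the projection
of `w` is unique, which forces `d_M(z) = O(ε)`; as `z` is an average of points of `A` that are
almost tangent to `M` at a projection of `z`, even `d_M(z) = O(ε²)`.

By (P4), in the case away from `M`, the point `z` is within `O(ε)` of a critical point `z'` of
`M`. For `y ∈ π_A(z)` and `x ∈ π_M(z')`, comparing distances gives
`‖y - z'‖² - ‖x - z'‖² ≤ 2 ⟪y - x, z - z'⟫ + O(ε²)`, and (P3) turns this into `‖y - x‖ = O(ε)` for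
some `x` (`CritDist.P3.exists_dist_lt`).

A critical point of `A` is the enclosing center of its projections, so it is determined by them.
The critical points near `z'` thus inject into the subsets of the intersection of `A` with the
`C₅ε`-neighborhood of `π_M(z')`, which has at most `N(δ, C₅ε)` points per projection of `z'`.
Finally, at small scale `M` is mapped to `ℝᵐ` by orthogonal projections to tangent spaces that
shrink distances at most by half, and comparing volumes of balls in `ℝᵐ` bounds the packing number
by `(5 C₅ε / δ)ᵐ`, where `δ ≤ C₅ε` because `C₅ ≥ 1`.
-/

namespace CritDist

/-! ### Closed convex hulls and smallest enclosing balls -/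

section Convex

variable {E : Type*} [NormedAddCommGroup E] [InnerProductSpace ℝ E]

theorem inner_le_of_mem_closure_convexHull {σ : Set E} {q v : E} {b : ℝ}
    (hq : q ∈ closure (convexHull ℝ σ)) (h : ∀ y ∈ σ, inner ℝ v y ≤ b) : inner ℝ v q ≤ b := by
  have hc : IsClosed {y : E | inner ℝ v y ≤ b} :=
    isClosed_le (continuous_const.inner continuous_id) continuous_const
  have hconv : Convex ℝ {y : E | inner ℝ v y ≤ b} :=
    convex_halfSpace_le (innerₛₗ ℝ v).isLinear b
  exact closure_minimal (convexHull_min h hconv) hc hq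

/-- The variational characterization of the point of a closed convex hull nearest to `w`. -/
theorem exists_nearest_closure_convexHull [CompleteSpace E] {σ : Set E} (hσ : σ.Nonempty)
    (w : E) : ∃ p ∈ closure (convexHull ℝ σ),
      ∀ q ∈ closure (convexHull ℝ σ), inner ℝ (w - p) (q - p) ≤ 0 := by
  have hconv : Convex ℝ (closure (convexHull ℝ σ)) := (convex_convexHull ℝ σ).closure
  obtain ⟨p, hp, hpw⟩ := exists_norm_eq_iInf_of_complete_convex (hσ.convexHull.closure)
    isClosed_closure.isComplete hconv w
  exact ⟨p, hp, (norm_eq_iInf_iff_real_inner_le_zero hconv hp).1 hpw⟩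

theorem mem_closure_convexHull_of_forall_inner [CompleteSpace E] {σ : Set E} {q : E}
    (h : ∀ v : E, ∃ y ∈ σ, inner ℝ v q ≤ inner ℝ v y) : q ∈ closure (convexHull ℝ σ) := by
  obtain ⟨y₀, hy₀, -⟩ := h 0
  obtain ⟨p, hp, hpq⟩ := exists_nearest_closure_convexHull ⟨y₀, hy₀⟩ q
  obtain ⟨y, hy, hqy⟩ := h (q - p)
  have h1 := hpq y (subset_closure (subset_convexHull ℝ σ hy))
  have h2 : inner ℝ (q - p) (q - p) ≤ 0 := by
    rw [inner_sub_right] at h1 ⊢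
    linarith
  rw [real_inner_self_nonpos, sub_eq_zero] at h2
  exact h2 ▸ hp

theorem norm_sub_sq_expand (x y z : E) :
    ‖x - y‖ ^ 2 = ‖x - z‖ ^ 2 + 2 * inner ℝ (x - z) (z - y) + ‖z - y‖ ^ 2 := by
  rw [← norm_add_sq_real, sub_add_sub_cancel]

/-- If `σ` lies on a sphere around `w`, then the center of the smallest ball enclosing `σ` is the
point of the closed convex hull of `σ` nearest to `w`: the ball around the nearest point `p` with
squared radius `R² - ‖w - p‖²` contains `σ`, and minimality forces `‖p - c‖ ≤ 0`. -/
theorem IsMinEnclosingCenter.mem_and_inner_le [CompleteSpace E] {σ : Set E} {w c : E} {R : ℝ}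
    (hσ : σ.Nonempty) (hR : ∀ y ∈ σ, dist y w = R) (hc : IsMinEnclosingCenter σ c) :
    c ∈ closure (convexHull ℝ σ) ∧
      ∀ q ∈ closure (convexHull ℝ σ), inner ℝ (w - c) (q - c) ≤ 0 := by
  obtain ⟨p, hp, hpw⟩ := exists_nearest_closure_convexHull hσ w
  obtain ⟨r, hr, hmin⟩ := hc
  have hencl : ∀ y ∈ σ, ‖y - p‖ ^ 2 ≤ R ^ 2 - ‖w - p‖ ^ 2 := by
    intro y hy
    have h1 := hpw y (subset_closure (subset_convexHull ℝ σ hy))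
    have h2 := norm_sub_sq_expand y w p
    have h3 : inner ℝ (y - p) (p - w) = -inner ℝ (w - p) (y - p) := by
      rw [← neg_sub w p, inner_neg_right, real_inner_comm]
    rw [← dist_eq_norm y w, hR y hy, h3, norm_sub_rev p w] at h2
    linarith
  obtain ⟨y₀, hy₀⟩ := hσ
  have hnn : 0 ≤ R ^ 2 - ‖w - p‖ ^ 2 := (sq_nonneg _).trans (hencl y₀ hy₀)
  have hr0 : 0 ≤ r := dist_nonneg.trans (hr hy₀)
  have hr2 : r ^ 2 ≤ R ^ 2 - ‖w - p‖ ^ 2 := by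
    have := hmin p (√(R ^ 2 - ‖w - p‖ ^ 2)) fun y hy => by
      rw [Metric.mem_closedBall, dist_eq_norm]
      exact Real.le_sqrt_of_sq_le (hencl y hy)
    calc r ^ 2 ≤ √(R ^ 2 - ‖w - p‖ ^ 2) ^ 2 := by gcongr
      _ = _ := Real.sq_sqrt hnn
  have hav : inner ℝ (w - c) p ≤
      (r ^ 2 - R ^ 2 - ‖w - c‖ ^ 2) / 2 + inner ℝ (w - c) w := by
    refine inner_le_of_mem_closure_convexHull hp fun y hy => ?_
    have h1 := norm_sub_sq_expand y c w
    have h2 : ‖y - c‖ ^ 2 ≤ r ^ 2 := by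
      have : ‖y - c‖ ≤ r := by simpa [dist_eq_norm] using hr hy
      gcongr
    rw [← dist_eq_norm y w, hR y hy, real_inner_comm, inner_sub_right] at h1
    linarith
  have hpc : ‖p - c‖ ^ 2 ≤ 0 := by
    have h1 := norm_sub_sq_expand p c w
    rw [real_inner_comm, inner_sub_right, norm_sub_rev p w] at h1
    linarith
  have : p = c := by
    have h := pow_eq_zero_iff (two_ne_zero) |>.1 (le_antisymm hpc (sq_nonneg _))
    rwa [norm_eq_zero, sub_eq_zero] at h
  exact this ▸ ⟨hp, hpw⟩

end Convex

/-! ### Projections and the generalized gradient -/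

section Gradient

variable {D : ℕ}

local notation "𝔼" => EuclideanSpace ℝ (Fin D)

theorem dist_eq_of_mem_proj {S : Set 𝔼} {x y : 𝔼} (hy : y ∈ proj S x) :
    dist y x = Metric.infDist x S := by
  rw [dist_comm, hy.2]

theorem isMinEnclosingCenter_enclosingCenter {S : Set 𝔼} {x : 𝔼} (h : (proj S x).Nonempty) :
    IsMinEnclosingCenter (proj S x) (enclosingCenter (proj S x)) := by
  have hb : Bornology.IsBounded (proj S x) :=
    (Metric.isBounded_closedBall (x := x) (r := Metric.infDist x S)).subset
      fun y hy => (dist_eq_of_mem_proj hy).le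
  exact Classical.epsilon_spec (existsUnique_isMinEnclosingCenter h hb).exists

theorem enclosingCenter_proj_mem_and_inner_le {S : Set 𝔼} {x : 𝔼} (h : (proj S x).Nonempty) :
    enclosingCenter (proj S x) ∈ closure (convexHull ℝ (proj S x)) ∧
      ∀ q ∈ closure (convexHull ℝ (proj S x)),
        inner ℝ (x - enclosingCenter (proj S x)) (q - enclosingCenter (proj S x)) ≤ 0 :=
  (isMinEnclosingCenter_enclosingCenter h).mem_and_inner_le h fun _ hy => dist_eq_of_mem_proj hy

theorem infDist_pos_of_proj_nonempty {S : Set 𝔼} {x : 𝔼} (hx : x ∉ S)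
    (h : (proj S x).Nonempty) : 0 < Metric.infDist x S := by
  obtain ⟨y, hy, hd⟩ := h
  rw [hd]
  exact dist_pos.2 fun h => hx (h ▸ hy)

theorem proj_nonempty {M : Set 𝔼} (hM : IsCompact M) (hne : M.Nonempty) (x : 𝔼) :
    (proj M x).Nonempty := by
  obtain ⟨y, hy, h⟩ := hM.exists_infDist_eq_dist hne x
  exact ⟨y, hy, h⟩

theorem norm_gradDist {S : Set 𝔼} {x : 𝔼} (hx : x ∉ S) :
    ‖gradDist S x‖ = ‖x - enclosingCenter (proj S x)‖ / Metric.infDist x S := by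
  rw [gradDist, if_neg hx, norm_smul, norm_inv, Real.norm_of_nonneg Metric.infDist_nonneg]
  ring

theorem eq_enclosingCenter_of_mem_criticalPoints {S : Set 𝔼} {z : 𝔼}
    (hz : z ∈ criticalPoints S) : z = enclosingCenter (proj S z) := by
  obtain ⟨hzS, hne, hg⟩ := hz
  rw [gradDist, if_neg hzS, smul_eq_zero, sub_eq_zero] at hg
  exact hg.resolve_left (inv_ne_zero (infDist_pos_of_proj_nonempty hzS hne).ne')

theorem mem_closure_convexHull_of_mem_criticalPoints {S : Set 𝔼} {z : 𝔼}
    (hz : z ∈ criticalPoints S) : z ∈ closure (convexHull ℝ (proj S z)) := by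
  have h := (enclosingCenter_proj_mem_and_inner_le hz.2.1).1
  rwa [← eq_enclosingCenter_of_mem_criticalPoints hz] at h

theorem norm_gradDist_le {S : Set 𝔼} {x q : 𝔼} (hx : x ∉ S) (h : (proj S x).Nonempty)
    (hq : q ∈ closure (convexHull ℝ (proj S x))) :
    ‖gradDist S x‖ ≤ ‖x - q‖ / Metric.infDist x S := by
  rw [norm_gradDist hx]
  have h1 := (enclosingCenter_proj_mem_and_inner_le h).2 q hq
  have h2 := norm_sub_sq_expand x q (enclosingCenter (proj S x))
  rw [← neg_sub q (enclosingCenter _), inner_neg_right, norm_neg] at h2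
  have h3 : ‖x - enclosingCenter (proj S x)‖ ≤ ‖x - q‖ := by
    apply le_of_sq_le_sq _ (norm_nonneg _)
    nlinarith [sq_nonneg ‖q - enclosingCenter (proj S x)‖]
  exact div_le_div_of_nonneg_right h3 Metric.infDist_nonneg

theorem norm_gradDist_of_proj_eq_singleton {S : Set 𝔼} {x y : 𝔼} (hx : x ∉ S)
    (h : proj S x = {y}) : ‖gradDist S x‖ = 1 := by
  have hy : y ∈ proj S x := by simp [h]
  have h1 := (enclosingCenter_proj_mem_and_inner_le ⟨y, hy⟩).1
  have h2 : enclosingCenter (proj S x) = y := by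
    rw [h] at h1 ⊢
    simpa using h1
  rw [norm_gradDist hx, h2, hy.2, dist_eq_norm, div_self]
  exact norm_ne_zero_iff.2 (sub_ne_zero.2 fun h => hx (h ▸ hy.1))

/-- At a critical point the squared distance function grows at most quadratically, as some
projection lies in every closed half-space whose boundary passes through the point. -/
theorem infDist_sq_le_of_mem_criticalPoints {A : Set 𝔼} {z : 𝔼} (hz : z ∈ criticalPoints A)
    (x : 𝔼) : Metric.infDist x A ^ 2 ≤ Metric.infDist z A ^ 2 + ‖x - z‖ ^ 2 := by
  have h := inner_le_of_mem_closure_convexHull (v := x - z)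
    (b := (Metric.infDist z A ^ 2 + ‖x - z‖ ^ 2 - Metric.infDist x A ^ 2) / 2
      + inner ℝ (x - z) z) (mem_closure_convexHull_of_mem_criticalPoints hz) fun y hy => by
    have h1 := norm_sub_sq_expand x y z
    have h2 : Metric.infDist x A ^ 2 ≤ ‖x - y‖ ^ 2 := by
      have := Metric.infDist_le_dist_of_mem (x := x) hy.1
      rw [dist_eq_norm] at this
      have h0 := Metric.infDist_nonneg (x := x) (s := A)
      gcongr
    rw [← dist_eq_norm z y, ← hy.2, inner_sub_right] at h1
    linarith
  linarith

/-- Maximizing `d_M² - 2‖· - z‖²` yields a point `w` at which the closed convex hull of the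
projections contains `2z - w`, a point at distance `2‖w - z‖` from `w`. -/
theorem exists_two_smul_sub_mem_closure_convexHull {M : Set 𝔼} (hM : IsCompact M)
    (hne : M.Nonempty) (z : 𝔼) :
    ∃ w, Metric.infDist z M ^ 2 + 2 * ‖w - z‖ ^ 2 ≤ Metric.infDist w M ^ 2 ∧
      (2 : ℝ) • z - w ∈ closure (convexHull ℝ (proj M w)) := by
  set d := Metric.infDist z M with hd
  have hd0 : 0 ≤ d := Metric.infDist_nonneg
  let g : 𝔼 → ℝ := fun x => Metric.infDist x M ^ 2 - 2 * ‖x - z‖ ^ 2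
  have hg : Continuous g := by
    have := Metric.continuous_infDist_pt M
    fun_prop
  have hz : z ∈ Metric.closedBall z (2 * d) := Metric.mem_closedBall_self (by linarith)
  obtain ⟨w, -, hw⟩ := (isCompact_closedBall z (2 * d)).exists_isMaxOn ⟨z, hz⟩ hg.continuousOn
  have hgz : g z = d ^ 2 := by simp [g, hd]
  -- Outside the ball of radius `2d`, `g x ≤ (d + ‖x - z‖)² - 2‖x - z‖² ≤ d² = g z`.
  have hmax : ∀ x, g x ≤ g w := by
    intro x
    by_cases hx : x ∈ Metric.closedBall z (2 * d)
    · exact hw hx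
    · refine le_trans ?_ (hw hz)
      rw [Metric.mem_closedBall, not_le, dist_eq_norm] at hx
      have h1 : Metric.infDist x M ≤ d + ‖x - z‖ := by
        rw [← dist_eq_norm]
        exact Metric.infDist_le_infDist_add_dist
      have h0 := Metric.infDist_nonneg (x := x) (s := M)
      rw [hgz]
      simp only [g]
      nlinarith [norm_nonneg (x - z)]
  refine ⟨w, by have := hmax z; rw [hgz] at this; simp only [g] at this; linarith,
    mem_closure_convexHull_of_forall_inner fun v => ?_⟩
  -- Projections of `w + v / (n + 1)` accumulate at a projection of `w`.
  have hyn := fun n : ℕ => proj_nonempty hM hne (w + (1 / ((n : ℝ) + 1)) • v)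
  choose y hy using hyn
  obtain ⟨y₀, hy₀, φ, hφ, hlim⟩ := hM.tendsto_subseq fun n => (hy n).1
  have ht : Filter.Tendsto (fun n : ℕ => 1 / (((φ n : ℕ) : ℝ) + 1)) Filter.atTop (nhds 0) :=
    tendsto_one_div_add_atTop_nhds_zero_nat.comp hφ.tendsto_atTop
  have hx : Filter.Tendsto (fun n : ℕ => w + (1 / (((φ n : ℕ) : ℝ) + 1)) • v) Filter.atTop
      (nhds w) := by
    simpa using tendsto_const_nhds.add (ht.smul_const v)
  refine ⟨y₀, ⟨hy₀, ?_⟩, ?_⟩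
  · refine tendsto_nhds_unique (((Metric.continuous_infDist_pt M).tendsto w).comp hx) ?_
    exact (hx.dist hlim).congr fun n => (hy (φ n)).2.symm
  · have key : ∀ n : ℕ, inner ℝ v ((2 : ℝ) • z - w) ≤
        inner ℝ v (y n) + (1 / ((n : ℝ) + 1)) * (‖v‖ ^ 2 / 2) := by
      intro n
      have htn : 0 < 1 / ((n : ℝ) + 1) := by positivity
      have hyn := hy n
      have hm := hmax (w + (1 / ((n : ℝ) + 1)) • v)
      set t := 1 / ((n : ℝ) + 1)
      simp only [g] at hm
      rw [hyn.2, dist_eq_norm] at hm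
      have e1 : ‖w + t • v - y n‖ ^ 2
          = ‖w - y n‖ ^ 2 + 2 * (t * inner ℝ v (w - y n)) + t ^ 2 * ‖v‖ ^ 2 := by
        rw [show w + t • v - y n = (w - y n) + t • v by abel, norm_add_sq_real, inner_smul_right,
          real_inner_comm, norm_smul, Real.norm_of_nonneg htn.le, mul_pow]
      have e2 : ‖w + t • v - z‖ ^ 2
          = ‖w - z‖ ^ 2 + 2 * (t * inner ℝ v (w - z)) + t ^ 2 * ‖v‖ ^ 2 := by
        rw [show w + t • v - z = (w - z) + t • v by abel, norm_add_sq_real, inner_smul_right,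
          real_inner_comm, norm_smul, Real.norm_of_nonneg htn.le, mul_pow]
      have e3 : Metric.infDist w M ^ 2 ≤ ‖w - y n‖ ^ 2 := by
        have := Metric.infDist_le_dist_of_mem (x := w) hyn.1
        rw [dist_eq_norm] at this
        have h0 := Metric.infDist_nonneg (x := w) (s := M)
        gcongr
      rw [e1, e2] at hm
      simp only [inner_sub_right, inner_smul_right] at hm ⊢
      have : t * (2 * inner ℝ v z - inner ℝ v w) ≤ t * (inner ℝ v (y n) + t * (‖v‖ ^ 2 / 2)) := by
        nlinarith
      exact le_of_mul_le_mul_left this htn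
    have hl : Filter.Tendsto (fun n : ℕ => inner ℝ v (y (φ n)) +
        (1 / (((φ n : ℕ) : ℝ) + 1)) * (‖v‖ ^ 2 / 2)) Filter.atTop (nhds (inner ℝ v y₀)) := by
      simpa using ((tendsto_const_nhds (x := v)).inner hlim).add (ht.mul_const (‖v‖ ^ 2 / 2))
    exact ge_of_tendsto' hl fun n => key (φ n)

end Gradient

/-! ### Local geometry of `C²` submanifolds -/

section Charts

variable {D m : ℕ}

local notation "𝔼" => EuclideanSpace ℝ (Fin D)

/-- A `C²` immersed chart `φ` at `u₀` that parametrizes a neighborhood of `φ u₀` in `M` by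
arbitrarily small neighborhoods of `u₀`. -/
theorem IsC2Submanifold.exists_chart {M : Set 𝔼} (hM : IsC2Submanifold m M) {x₀ : 𝔼}
    (hx₀ : x₀ ∈ M) :
    ∃ (φ : EuclideanSpace ℝ (Fin m) → 𝔼) (u₀ : EuclideanSpace ℝ (Fin m)),
      ContDiffAt ℝ 2 φ u₀ ∧ Function.Injective (fderiv ℝ φ u₀) ∧ φ u₀ = x₀ ∧
      (∀ᶠ u in nhds u₀, φ u ∈ M) ∧
      ∀ N ∈ nhds u₀, ∀ᶠ y in nhds x₀, y ∈ M → ∃ u ∈ N, φ u = y := by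
  obtain ⟨U, V, φ, hU, hV, hxV, hφ, hinj, himg, hemb⟩ := hM x₀ hx₀
  obtain ⟨u₀, hu₀, rfl⟩ : x₀ ∈ φ '' U := himg ▸ ⟨hx₀, hxV⟩
  refine ⟨φ, u₀, hφ.contDiffAt (hU.mem_nhds hu₀), hinj u₀ hu₀, rfl, ?_, fun N hN => ?_⟩
  · filter_upwards [hU.mem_nhds hu₀] with u hu
    have : φ u ∈ M ∩ V := himg ▸ Set.mem_image_of_mem φ hu
    exact this.1
  · have h1 : (Subtype.val : U → _) ⁻¹' N ∈ nhds (⟨u₀, hu₀⟩ : U) :=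
      continuous_subtype_val.continuousAt.preimage_mem_nhds hN
    rw [hemb.isInducing.nhds_eq_comap, Filter.mem_comap] at h1
    obtain ⟨W, hW, hWN⟩ := h1
    filter_upwards [hW, hV.mem_nhds hxV] with y hyW hyV hyM
    obtain ⟨u, hu, rfl⟩ : y ∈ φ '' U := himg ▸ ⟨hyM, hyV⟩
    exact ⟨u, hWN (show (⟨u, hu⟩ : U) ∈ _ from hyW), rfl⟩

/-- An injective derivative `L` at `u₀` is bounded below, and dominates the first-order error. -/
theorem exists_lower_bound_of_injective_fderiv {φ : EuclideanSpace ℝ (Fin m) → 𝔼}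
    {u₀ : EuclideanSpace ℝ (Fin m)} (hφ : ContDiffAt ℝ 2 φ u₀)
    (hinj : Function.Injective (fderiv ℝ φ u₀)) :
    ∃ κ : ℝ, 0 < κ ∧ (∀ h, κ * ‖h‖ ≤ ‖fderiv ℝ φ u₀ h‖) ∧
      ∃ N ∈ nhds u₀, ∀ u ∈ N, ∀ v ∈ N,
        ‖φ v - φ u - fderiv ℝ φ u₀ (v - u)‖ ≤ κ / 3 * ‖v - u‖ := by
  obtain ⟨K, hK, hL⟩ := (fderiv ℝ φ u₀).toLinearMap.exists_antilipschitzWith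
    (LinearMap.ker_eq_bot.2 hinj)
  have hK' : (0 : ℝ) < K := hK
  have hs := hφ.hasStrictFDerivAt (by norm_num)
  have hpos : 0 < (K : ℝ)⁻¹ / 3 := by positivity
  have he := hs.isLittleO.def hpos
  rw [nhds_prod_eq] at he
  obtain ⟨N, hN, hsub⟩ := Filter.mem_prod_same_iff.1 he
  refine ⟨(K : ℝ)⁻¹, inv_pos.2 hK', fun h => ?_, N, hN,
    fun u hu v hv => ?_⟩
  · rw [inv_mul_le_iff₀ hK']
    simpa [dist_zero_right] using hL.le_mul_dist h 0
  · have := hsub (Set.mk_mem_prod hv hu)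
    rwa [Set.mem_ofPred_eq] at this

/-- `M` stays quadratically close to its tangent spaces: the displacement `y - x` between points
of `M` is orthogonal, up to an error of order `‖y - x‖²`, to the directions `z - x` normal to `M`
at `x`. Only normals coming from projections `x ∈ π_M(z)` are considered, which avoids tangent
spaces. -/
def NormalQuadraticBound (K : ℝ) (M : Set 𝔼) : Prop :=
  ∀ z, ∀ x ∈ proj M z, ∀ y ∈ M, |inner ℝ (z - x) (y - x)| ≤ K * ‖z - x‖ * ‖y - x‖ ^ 2

theorem eventually_normal_quadratic_bound {M : Set 𝔼} (hM : IsC2Submanifold m M) {x₀ : 𝔼}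
    (hx₀ : x₀ ∈ M) :
    ∃ K : ℝ, ∃ W ∈ nhds x₀, ∀ x ∈ W, ∀ y ∈ W, y ∈ M → ∀ z, x ∈ proj M z →
      |inner ℝ (z - x) (y - x)| ≤ K * ‖z - x‖ * ‖y - x‖ ^ 2 := by
  obtain ⟨φ, u₀, hφ, hinj, rfl, hmem, hsurj⟩ := hM.exists_chart hx₀
  obtain ⟨κ, hκ, hL, N, hN, hNφ⟩ := exists_lower_bound_of_injective_fderiv hφ hinj
  obtain ⟨K, t, ht, hlip⟩ :=
    (hφ.fderiv_right (m := 1) (by norm_num)).exists_lipschitzOnWith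
  have hdiff : ∀ᶠ u in nhds u₀, DifferentiableAt ℝ φ u :=
    (hφ.eventually (by simp)).mono fun u hu => hu.differentiableAt (by norm_num)
  have hall := Filter.inter_mem (Filter.inter_mem hN ht) (Filter.inter_mem hmem hdiff)
  obtain ⟨r, hr, hball⟩ := Metric.mem_nhds_iff.1 hall
  refine ⟨K * (3 / (2 * κ)) ^ 2, _, hsurj _ (Metric.ball_mem_nhds u₀ hr), ?_⟩
  intro x hx y hy hyM z hxz
  obtain ⟨u, hu, rfl⟩ := hx hxz.1
  obtain ⟨v, hv, rfl⟩ := hy hyM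
  have hdu : DifferentiableAt ℝ φ u := (hball hu).2.2
  -- `u` is a local minimum of `‖φ · - z‖²`, so that `z - φ u` is normal to `M`.
  have hnormal : ∀ h, inner ℝ (z - φ u) (fderiv ℝ φ u h) = 0 := by
    intro h
    have hmin : IsLocalMin (fun s => ‖φ s - z‖ ^ 2) u := by
      filter_upwards [Metric.isOpen_ball.mem_nhds hu] with s hs
      have h1 := Metric.infDist_le_dist_of_mem (x := z) (hball hs).2.1
      rw [hxz.2, dist_comm, dist_eq_norm, dist_comm, dist_eq_norm] at h1
      gcongr
    have hd := (hdu.hasFDerivAt.sub_const z).norm_sq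
    have h0 := hmin.hasFDerivAt_eq_zero hd
    have h1 := congrArg (fun T => T h) h0
    rw [← neg_sub, inner_neg_left, neg_eq_zero, inner_sub_left]
    simpa using h1
  have hseg : ∀ s ∈ segment ℝ u v, s ∈ Metric.ball u₀ r :=
    fun s hs => (convex_ball u₀ r).segment_subset hu hv hs
  have hquad : ‖φ v - φ u - fderiv ℝ φ u (v - u)‖ ≤ K * ‖v - u‖ * ‖v - u‖ := by
    refine (convex_segment u v).norm_image_sub_le_of_norm_hasFDerivWithin_le'
      (f' := fderiv ℝ φ) (fun s hs => (hball (hseg s hs)).2.2.hasFDerivAt.hasFDerivWithinAt)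
      (fun s hs => ?_) (left_mem_segment ℝ u v) (right_mem_segment ℝ u v)
    refine (hlip.norm_sub_le (hball (hseg s hs)).1.2 (hball hu).1.2).trans ?_
    gcongr
    obtain ⟨θ, hθ, rfl⟩ := segment_eq_image' ℝ u v ▸ hs
    rw [add_sub_cancel_left, norm_smul, Real.norm_of_nonneg hθ.1]
    exact mul_le_of_le_one_left (norm_nonneg _) hθ.2
  have hlow : ‖v - u‖ ≤ 3 / (2 * κ) * ‖φ v - φ u‖ := by
    have h1 := hNφ u (hball hu).1.1 v (hball hv).1.1
    have h2 := hL (v - u)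
    have h3 := norm_sub_norm_le (fderiv ℝ φ u₀ (v - u)) (φ v - φ u)
    rw [norm_sub_rev (fderiv ℝ φ u₀ (v - u)) (φ v - φ u)] at h3
    rw [div_mul_eq_mul_div, le_div_iff₀ (by positivity)]
    linarith
  have hsplit : inner ℝ (z - φ u) (φ v - φ u)
      = inner ℝ (z - φ u) (φ v - φ u - fderiv ℝ φ u (v - u)) := by
    rw [inner_sub_right _ (φ v - φ u), hnormal, sub_zero]
  rw [hsplit]
  calc _ ≤ ‖z - φ u‖ * ‖φ v - φ u - fderiv ℝ φ u (v - u)‖ := abs_real_inner_le_norm _ _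
    _ ≤ ‖z - φ u‖ * (K * (3 / (2 * κ) * ‖φ v - φ u‖) * (3 / (2 * κ) * ‖φ v - φ u‖)) := by
      gcongr
      exact hquad.trans (by gcongr)
    _ = _ := by ring

/-- The local bounds extend to a compact submanifold by compactness of `M × M`: away from the
diagonal the bound follows from the Cauchy–Schwarz inequality. -/
theorem exists_normalQuadraticBound {M : Set 𝔼} (hM : IsCompact M) (hC : IsC2Submanifold m M) :
    ∃ K : ℝ, 0 < K ∧ NormalQuadraticBound K M := by
  let p : Set (𝔼 × 𝔼) → Prop := fun s => ∃ K : ℝ, ∀ q ∈ s, q.2 ∈ M → ∀ z, q.1 ∈ proj M z →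
    |inner ℝ (z - q.1) (q.2 - q.1)| ≤ K * ‖z - q.1‖ * ‖q.2 - q.1‖ ^ 2
  have hp : p (M ×ˢ M) := by
    refine (hM.prod hM).induction_on (p := p) ⟨0, by simp⟩ ?_ ?_ ?_
    · rintro s t hst ⟨K, hK⟩
      exact ⟨K, fun q hq => hK q (hst hq)⟩
    · rintro s t ⟨K, hK⟩ ⟨K', hK'⟩
      refine ⟨max K K', fun q hq hqM z hz => ?_⟩
      rcases hq with hq | hq
      · exact (hK q hq hqM z hz).trans (by gcongr; exact le_max_left _ _)
      · exact (hK' q hq hqM z hz).trans (by gcongr; exact le_max_right _ _)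
    · rintro ⟨a, b⟩ ⟨ha, -⟩
      by_cases hab : a = b
      · subst hab
        obtain ⟨K, W, hW, h⟩ := eventually_normal_quadratic_bound hC ha
        exact ⟨W ×ˢ W, mem_nhdsWithin_of_mem_nhds (prod_mem_nhds hW hW), K,
          fun q hq hqM z hz => h _ hq.1 _ hq.2 hqM z hz⟩
      · have hd : 0 < ‖b - a‖ := norm_pos_iff.2 (sub_ne_zero.2 (Ne.symm hab))
        refine ⟨{q | ‖b - a‖ / 2 < ‖q.2 - q.1‖}, mem_nhdsWithin_of_mem_nhds
          ((isOpen_lt continuous_const (by fun_prop)).mem_nhds ?_), 2 / ‖b - a‖, ?_⟩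
        · simp only [Set.mem_ofPred_eq]
          linarith
        · intro q hq _ z _
          rw [Set.mem_ofPred_eq] at hq
          refine (abs_real_inner_le_norm _ _).trans ?_
          have h1 : 1 ≤ 2 / ‖b - a‖ * ‖q.2 - q.1‖ := by
            rw [div_mul_eq_mul_div, le_div_iff₀ hd]
            linarith
          calc ‖z - q.1‖ * ‖q.2 - q.1‖ = ‖z - q.1‖ * ‖q.2 - q.1‖ * 1 := by ring
            _ ≤ ‖z - q.1‖ * ‖q.2 - q.1‖ * (2 / ‖b - a‖ * ‖q.2 - q.1‖) := by gcongr
            _ = _ := by ring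
  obtain ⟨K, hK⟩ := hp
  refine ⟨max K 1, by positivity, fun z x hx y hy => (hK (x, y) ⟨hx.1, hy⟩ hy z hx).trans ?_⟩
  gcongr
  exact le_max_left _ _

/-- A linear chart at small scale: the orthogonal projection to a tangent space, in orthonormal
coordinates, shrinks distances in `M` by a factor of at most two. -/
theorem exists_linear_chart {M : Set 𝔼} (hM : IsC2Submanifold m M) {x₀ : 𝔼} (hx₀ : x₀ ∈ M) :
    ∃ W ∈ nhds x₀, ∃ T : 𝔼 →L[ℝ] EuclideanSpace ℝ (Fin m), ∀ x ∈ W, ∀ y ∈ W, x ∈ M → y ∈ M →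
      ‖x - y‖ / 2 ≤ ‖T x - T y‖ ∧ ‖T x - T y‖ ≤ ‖x - y‖ := by
  obtain ⟨φ, u₀, hφ, hinj, rfl, -, hsurj⟩ := hM.exists_chart hx₀
  obtain ⟨κ, hκ, hL, N, hN, hNφ⟩ := exists_lower_bound_of_injective_fderiv hφ hinj
  set L := fderiv ℝ φ u₀
  let F : Submodule ℝ 𝔼 := LinearMap.range L.toLinearMap
  have hF : Module.finrank ℝ F = m := by
    rw [LinearMap.finrank_range_of_inj hinj]
    simp
  let e : F ≃ₗᵢ[ℝ] EuclideanSpace ℝ (Fin m) :=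
    ((stdOrthonormalBasis ℝ F).reindex (finCongr hF)).repr
  let T : 𝔼 →L[ℝ] EuclideanSpace ℝ (Fin m) :=
    (e.toContinuousLinearEquiv : F →L[ℝ] _).comp F.orthogonalProjectionOnto
  have hT : ∀ x, ‖T x‖ ≤ ‖x‖ := fun x => by
    have : ‖T x‖ = ‖F.orthogonalProjectionOnto x‖ := e.norm_map _
    rw [this]
    exact F.norm_orthogonalProjectionOnto_apply_le x
  have hTL : ∀ h, ‖T (L h)‖ = ‖L h‖ := fun h => by
    have : ‖T (L h)‖ = ‖F.orthogonalProjectionOnto (L h)‖ := e.norm_map _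
    rw [this, Submodule.orthogonalProjectionOnto_mem_subspace_eq_self (K := F) ⟨L h, h, rfl⟩]
    rfl
  refine ⟨_, hsurj N hN, T, fun x hx y hy hxM hyM => ?_⟩
  obtain ⟨v, hv, rfl⟩ := hx hxM
  obtain ⟨u, hu, rfl⟩ := hy hyM
  rw [← map_sub]
  refine ⟨?_, hT _⟩
  have h1 := hNφ u hu v hv
  have h2 := hL (v - u)
  have h3 := hT (φ v - φ u - L (v - u))
  rw [map_sub] at h3
  have h4 := norm_sub_norm_le (T (L (v - u))) (T (φ v - φ u))
  rw [norm_sub_rev (T (L (v - u))), hTL] at h4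
  have h5 := norm_sub_norm_le (φ v - φ u) (L (v - u))
  linarith

end Charts

/-! ### Packing numbers -/

section Packing

/-- The volume bound for separated subsets of a ball: balls of radius `δ / 2` around the points
are disjoint and contained in the ball of radius `r + δ / 2`. -/
theorem ncard_le_of_separated_of_subset_ball {m : ℕ} {P : Set (EuclideanSpace ℝ (Fin m))}
    {p : EuclideanSpace ℝ (Fin m)} {r δ : ℝ} (hδ : 0 < δ) (hr : 0 ≤ r) (hP : P.Finite)
    (hsub : P ⊆ Metric.ball p r) (hsep : P.Pairwise fun x y => δ ≤ dist x y) :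
    (P.ncard : ℝ) ≤ ((r + δ / 2) / (δ / 2)) ^ m := by
  have hdisj : P.PairwiseDisjoint fun x => Metric.ball x (δ / 2) := fun x hx y hy hxy =>
    Metric.ball_disjoint_ball (by linarith [hsep hx hy hxy])
  set μ : MeasureTheory.Measure (EuclideanSpace ℝ (Fin m)) := MeasureTheory.volume
  have h1 : ∑ x ∈ hP.toFinset, μ (Metric.ball x (δ / 2)) ≤ μ (Metric.ball p (r + δ / 2)) := by
    rw [← MeasureTheory.measure_biUnion_finset (by simpa using hdisj)
      fun _ _ => measurableSet_ball]
    refine MeasureTheory.measure_mono (Set.iUnion₂_subset fun x hx => ?_)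
    refine Metric.ball_subset_ball' ?_
    have := Metric.mem_ball.1 (hsub (hP.mem_toFinset.1 hx))
    linarith
  have hb0 : μ (Metric.ball 0 1) ≠ 0 := (Metric.measure_ball_pos μ 0 one_pos).ne'
  have hbt : μ (Metric.ball 0 1) ≠ ⊤ := MeasureTheory.measure_ball_lt_top.ne
  have h2 : ∀ x, μ (Metric.ball x (δ / 2)) = ENNReal.ofReal ((δ / 2) ^ m) * μ (Metric.ball 0 1) :=
    fun x => by simpa using MeasureTheory.Measure.addHaar_ball_of_pos μ x (half_pos hδ)
  have h3 : μ (Metric.ball p (r + δ / 2)) =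
      ENNReal.ofReal ((r + δ / 2) ^ m) * μ (Metric.ball 0 1) := by
    simpa using MeasureTheory.Measure.addHaar_ball_of_pos μ p (by linarith : 0 < r + δ / 2)
  rw [h3, Finset.sum_congr rfl fun x _ => h2 x, Finset.sum_const, nsmul_eq_mul, ← mul_assoc,
    ENNReal.mul_le_mul_iff_left hb0 hbt, ← ENNReal.ofReal_natCast,
    ← ENNReal.ofReal_mul (by positivity), ENNReal.ofReal_le_ofReal_iff (by positivity),
    ← Set.ncard_eq_toFinset_card P hP] at h1
  rwa [div_pow, le_div_iff₀ (by positivity)]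

theorem exists_packingNumber_le {D m : ℕ} {M : Set (EuclideanSpace ℝ (Fin D))}
    (hM : IsCompact M) (hC : IsC2Submanifold m M) :
    ∃ r₀ : ℝ, 0 < r₀ ∧ ∀ δ r, 0 < δ → δ ≤ r → r ≤ r₀ →
      (packingNumber M δ r : ℝ) ≤ (5 * r / δ) ^ m := by
  have hch := fun x : M => exists_linear_chart hC x.2
  choose W hW T hT using hch
  obtain ⟨r₀, hr₀, hleb⟩ := lebesgue_number_lemma_of_metric (c := fun x : M => interior (W x)) hM
    (fun _ => isOpen_interior)
    fun x hx => Set.mem_iUnion.2 ⟨⟨x, hx⟩, mem_interior_iff_mem_nhds.2 (hW ⟨x, hx⟩)⟩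
  refine ⟨r₀, hr₀, fun δ r hδ hδr hr => ?_⟩
  have hr0 : 0 < r := hδ.trans_le hδr
  rcases (packingCards M δ r).eq_empty_or_nonempty with he | hne
  · rw [packingNumber, he, csSup_empty, Nat.bot_eq_zero, Nat.cast_zero]
    positivity
  obtain ⟨x, hx, A, ⟨hA, hAs, -, hsep⟩, hcard⟩ :=
    Nat.sSup_mem hne (bddAbove_packingCards hM hδ r)
  obtain ⟨i, hi⟩ := hleb x hx
  have hAW : ∀ a ∈ A, a ∈ W i := fun a ha =>
    interior_subset (hi (Metric.ball_subset_ball hr (hAs ha).1))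
  have hxW : x ∈ W i := interior_subset (hi (Metric.mem_ball_self hr₀))
  have hsepT : ∀ a ∈ A, ∀ b ∈ A, a ≠ b → δ / 2 ≤ dist (T i a) (T i b) := by
    intro a ha b hb hab
    have h1 := (hT i a (hAW a ha) b (hAW b hb) (hAs ha).2 (hAs hb).2).1
    have h2 := hsep a ha b hb hab
    rw [dist_eq_norm]
    linarith
  have hinj : Set.InjOn (T i) A := by
    intro a ha b hb hab
    by_contra hne
    have := hsepT a ha b hb hne
    rw [hab, dist_self] at this
    linarith
  have hmain := ncard_le_of_separated_of_subset_ball (P := T i '' A) (p := T i x)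
    (half_pos hδ) hr0.le (hA.image _) ?_ ?_
  · rw [hinj.ncard_image, hcard] at hmain
    refine hmain.trans ?_
    have : (r + δ / 2 / 2) / (δ / 2 / 2) ≤ 5 * r / δ := by
      rw [div_le_div_iff₀ (by positivity) hδ]
      nlinarith
    gcongr
  · rintro _ ⟨a, ha, rfl⟩
    have h1 := (hT i a (hAW a ha) x hxW (hAs ha).2 hx).2
    have h2 := Metric.mem_ball.1 (hAs ha).1
    rw [dist_eq_norm] at h2
    rw [Metric.mem_ball, dist_eq_norm]
    exact h1.trans_lt h2
  · rintro _ ⟨a, ha, rfl⟩ _ ⟨b, hb, rfl⟩ hab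
    exact hsepT a ha b hb fun h => hab (h ▸ rfl)

end Packing

/-! ### Stability of critical points and of their projections -/

section Stability

variable {D : ℕ}

local notation "𝔼" => EuclideanSpace ℝ (Fin D)

/-- Uniqueness of projections near `M`: two projections `a`, `b` of `x` satisfy
`‖b - a‖² = 2 ⟪x - a, b - a⟫`. -/
theorem NormalQuadraticBound.proj_subsingleton {K : ℝ} {M : Set 𝔼}
    (hKM : NormalQuadraticBound K M) {x : 𝔼} (hx : 2 * K * Metric.infDist x M < 1) :
    (proj M x).Subsingleton := by
  intro a ha b hb
  have h1 := norm_sub_sq_expand b x a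
  have h2 := (le_abs_self _).trans (hKM x a ha b hb.1)
  rw [← dist_eq_norm b x, dist_eq_of_mem_proj hb, ← dist_eq_norm a x, dist_eq_of_mem_proj ha,
    ← neg_sub x a, inner_neg_right, real_inner_comm] at h1
  rw [← dist_eq_norm x a, ← ha.2] at h2
  have h3 : ‖b - a‖ ^ 2 * (1 - 2 * K * Metric.infDist x M) ≤ 0 := by linarith
  have h4 : ‖b - a‖ ^ 2 ≤ 0 := by
    by_contra! h
    nlinarith
  have h5 := pow_eq_zero_iff two_ne_zero |>.1 (le_antisymm h4 (sq_nonneg _))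
  rw [norm_eq_zero, sub_eq_zero] at h5
  exact h5.symm

/-- Sampling changes the squared distance function only to second order, since displacements
along `M` at a projection of `z` are nearly orthogonal to the direction of `z`. -/
theorem NormalQuadraticBound.infDist_sq_le {K : ℝ} {M A : Set 𝔼}
    (hKM : NormalQuadraticBound K M) (hK : 0 ≤ K) (hM : IsCompact M) (hne : M.Nonempty) {ε : ℝ}
    (hε : 0 < ε) (hAM : A ⊆ M) (hH : Metric.hausdorffEDist A M ≤ ENNReal.ofReal ε) (z : 𝔼) :
    Metric.infDist z A ^ 2 ≤
      Metric.infDist z M ^ 2 + (1 + 2 * K * Metric.infDist z M) * (2 * ε) ^ 2 := by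
  obtain ⟨x, hx⟩ := proj_nonempty hM hne z
  have hlt : Metric.hausdorffEDist M A < ENNReal.ofReal (2 * ε) := by
    rw [Metric.hausdorffEDist_comm]
    exact hH.trans_lt ((ENNReal.ofReal_lt_ofReal_iff (by linarith)).2 (by linarith))
  obtain ⟨a, ha, hxa⟩ := Metric.exists_edist_lt_of_hausdorffEDist_lt hx.1 hlt
  rw [edist_lt_ofReal, dist_comm, dist_eq_norm] at hxa
  have h1 := norm_sub_sq_expand z a x
  have h2 := (neg_le_abs _).trans (hKM z x hx a (hAM ha))
  rw [← dist_eq_norm z x, ← hx.2] at h1 h2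
  rw [← inner_neg_right, neg_sub] at h2
  have h3 : Metric.infDist z A ^ 2 ≤ ‖z - a‖ ^ 2 := by
    have h := Metric.infDist_le_dist_of_mem (x := z) ha
    rw [dist_eq_norm] at h
    have h0 := Metric.infDist_nonneg (x := z) (s := A)
    gcongr
  rw [norm_sub_rev x a] at h1
  have h4 : ‖a - x‖ ^ 2 ≤ (2 * ε) ^ 2 := by gcongr
  have h5 : 0 ≤ 2 * K * Metric.infDist z M := by
    have := Metric.infDist_nonneg (x := z) (s := M)
    positivity
  nlinarith

theorem infDist_le_diam_of_mem_criticalPoints {M A : Set 𝔼} (hM : IsCompact M) (hAM : A ⊆ M)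
    {z : 𝔼} (hz : z ∈ criticalPoints A) : Metric.infDist z M ≤ Metric.diam M := by
  obtain ⟨a, ha⟩ := hz.2.1
  have hsub : proj A z ⊆ Metric.closedBall a (Metric.diam M) := fun y hy =>
    Metric.dist_le_diam_of_mem hM.isBounded (hAM hy.1) (hAM ha.1)
  have h := closure_minimal (convexHull_min hsub (convex_closedBall _ _))
    Metric.isClosed_closedBall (mem_closure_convexHull_of_mem_criticalPoints hz)
  exact (Metric.infDist_le_dist_of_mem (hAM ha.1)).trans h

/-- A critical point `z` of `A ⊆ M` with `R = d_A(z)` is an average of points of `M` at distance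
at most `2R` from a projection `x ∈ π_M(z)`, and these points are almost tangent to `M` at `x`. -/
theorem NormalQuadraticBound.infDist_le_of_mem_criticalPoints {K : ℝ} {M A : Set 𝔼}
    (hKM : NormalQuadraticBound K M) (hK : 0 ≤ K) (hM : IsCompact M) (hAM : A ⊆ M) {z : 𝔼}
    (hz : z ∈ criticalPoints A) : Metric.infDist z M ≤ 4 * K * Metric.infDist z A ^ 2 := by
  have hne : A.Nonempty := hz.2.1.mono fun _ h => h.1
  obtain ⟨x, hx⟩ := proj_nonempty hM (hne.mono hAM) z
  have hdR : Metric.infDist z M ≤ Metric.infDist z A := Metric.infDist_le_infDist_of_subset hAM hne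
  have hd0 := Metric.infDist_nonneg (x := z) (s := M)
  have h := inner_le_of_mem_closure_convexHull (v := z - x)
    (b := inner ℝ (z - x) x + K * Metric.infDist z M * (2 * Metric.infDist z A) ^ 2)
    (mem_closure_convexHull_of_mem_criticalPoints hz) fun y hy => by
      have h1 := (le_abs_self _).trans (hKM z x hx y (hAM hy.1))
      rw [← dist_eq_norm z x, ← hx.2, inner_sub_right] at h1
      have h2 : ‖y - x‖ ≤ 2 * Metric.infDist z A := by
        have := dist_triangle y z x
        rw [dist_eq_of_mem_proj hy, ← hx.2, dist_eq_norm] at this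
        linarith
      have h3 : K * Metric.infDist z M * ‖y - x‖ ^ 2 ≤
          K * Metric.infDist z M * (2 * Metric.infDist z A) ^ 2 := by gcongr
      linarith
  have h1 : inner ℝ (z - x) (z - x) = Metric.infDist z M ^ 2 := by
    rw [real_inner_self_eq_norm_sq, ← dist_eq_norm, ← hx.2]
  rw [inner_sub_right] at h1
  rcases hd0.eq_or_lt with h0 | h0
  · rw [← h0]
    positivity
  · refine le_of_mul_le_mul_left ?_ h0
    linarith

/-- Each critical point `z` of a sample has at distance `O(ε)` a point `w` such that the closed
convex hull of `π_M(w)` contains a point within `O(ε)` of `w`. -/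
theorem exists_near_of_mem_criticalPoints {B : ℝ} {M A : Set 𝔼} (hM : IsCompact M)
    (hB : 0 ≤ B) {ε : ℝ} (hε : 0 < ε)
    (hAM : A ⊆ M) {z : 𝔼} (hz : z ∈ criticalPoints A)
    (hzA : Metric.infDist z A ^ 2 ≤ Metric.infDist z M ^ 2 + B ^ 2 * ε ^ 2) :
    ∃ w, ‖w - z‖ ≤ B * ε ∧ Metric.infDist z M ≤ Metric.infDist w M ∧
      (2 : ℝ) • z - w ∈ closure (convexHull ℝ (proj M w)) := by
  have hne : A.Nonempty := hz.2.1.mono fun _ h => h.1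
  obtain ⟨w, hw, hmem⟩ := exists_two_smul_sub_mem_closure_convexHull hM (hne.mono hAM) z
  have h1 := infDist_sq_le_of_mem_criticalPoints hz w
  have h2 : Metric.infDist w M ^ 2 ≤ Metric.infDist w A ^ 2 := by
    have h := Metric.infDist_le_infDist_of_subset (x := w) hAM hne
    have h0 := Metric.infDist_nonneg (x := w) (s := M)
    gcongr
  refine ⟨w, ?_, ?_, hmem⟩
  · refine le_of_sq_le_sq ?_ (by positivity)
    rw [mul_pow]
    linarith
  · refine le_of_sq_le_sq ?_ Metric.infDist_nonneg
    linarith [sq_nonneg ‖w - z‖]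

theorem norm_sub_two_smul_sub (z w : 𝔼) : ‖w - ((2 : ℝ) • z - w)‖ = 2 * ‖w - z‖ := by
  rw [show w - ((2 : ℝ) • z - w) = (2 : ℝ) • (w - z) by rw [smul_sub, two_smul, two_smul]; abel,
    norm_smul, Real.norm_ofNat]

/-- A critical point of a sample that is close to `M` is at distance `O(ε²)` from `M`. The point
`w` near it has a unique projection, which is then `2z - w`; so `d_M(z) = O(ε)`, and the quadratic
bound for critical points of subsets improves this to `O(ε²)`. -/
theorem NormalQuadraticBound.infDist_le_of_infDist_lt {K B : ℝ} {M A : Set 𝔼}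
    (hKM : NormalQuadraticBound K M) (hK : 0 < K) (hM : IsCompact M) (hB : 0 ≤ B) {ε : ℝ}
    (hε : 0 < ε) (hBε : K * B * ε ≤ 1 / 10) (hAM : A ⊆ M) {z : 𝔼} (hz : z ∈ criticalPoints A)
    (hzA : Metric.infDist z A ^ 2 ≤ Metric.infDist z M ^ 2 + B ^ 2 * ε ^ 2)
    (hzM : K * Metric.infDist z M < 1 / 4) : Metric.infDist z M ≤ 20 * K * B ^ 2 * ε ^ 2 := by
  have hne : M.Nonempty := (hz.2.1.mono fun _ h => h.1).mono hAM
  obtain ⟨w, hwz, hzw, hmem⟩ := exists_near_of_mem_criticalPoints hM hB hε hAM hz hzA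
  have h1 : Metric.infDist w M ≤ Metric.infDist z M + ‖w - z‖ := by
    rw [← dist_eq_norm]
    exact Metric.infDist_le_infDist_add_dist
  have h2 : (proj M w).Subsingleton := hKM.proj_subsingleton (by nlinarith)
  obtain ⟨x, hx⟩ := proj_nonempty hM hne w
  rw [h2.eq_singleton_of_mem hx] at hmem
  have h3 : (2 : ℝ) • z - w = x := by simpa using hmem
  have h4 : Metric.infDist w M = 2 * ‖w - z‖ := by
    rw [hx.2, ← h3, dist_eq_norm, norm_sub_two_smul_sub]
  have h5 : Metric.infDist z M ≤ 2 * (B * ε) := by linarith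
  have h6 : Metric.infDist z M ^ 2 ≤ (2 * (B * ε)) ^ 2 := by
    have h0 := Metric.infDist_nonneg (x := z) (s := M)
    gcongr
  have h7 := hKM.infDist_le_of_mem_criticalPoints hK.le hM hAM hz
  nlinarith

/-- Projections on `M` and on samples of points near a critical point `z'` lie near `π_M(z')`.
With `x ∈ π_M(z')`, comparing the distances of `y` and `x` to `z` and `z'` gives
`‖y - z'‖² - ‖x - z'‖² ≤ 2 ⟪y - x, z - z'⟫ + Q ε²`. Near `x` the left-hand side is at least
`α ‖y - x‖²` by (P3), so `‖y - x‖ = O(ε)`; away from `π_M(z')` it is bounded below. -/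
theorem P3.exists_dist_lt {M : Set 𝔼} (h3 : P3 M) (hM : IsCompact M) {z' : 𝔼}
    (hz' : z' ∈ criticalPoints M) {C₄ Q : ℝ} (hC₄ : 0 ≤ C₄) (hQ : 0 ≤ Q) :
    ∃ C > 0, ∃ η > 0, ∀ ε, 0 < ε → ε ≤ η → ∀ z, dist z z' ≤ C₄ * ε → ∀ y ∈ M,
      ‖y - z‖ ^ 2 ≤ Metric.infDist z M ^ 2 + Q * ε ^ 2 → ∃ x ∈ proj M z', dist y x < C * ε := by
  have key : ∀ x ∈ M, ∀ (y z : 𝔼) (ε : ℝ), dist z z' ≤ C₄ * ε →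
      ‖y - z‖ ^ 2 ≤ Metric.infDist z M ^ 2 + Q * ε ^ 2 →
      ‖y - z'‖ ^ 2 - ‖x - z'‖ ^ 2 ≤ 2 * (‖y - x‖ * (C₄ * ε)) + Q * ε ^ 2 := by
    intro x hx y z ε hz hy
    have e1 := norm_sub_sq_expand y z' z
    have e2 := norm_sub_sq_expand x z' z
    have e3 : inner ℝ (y - x) (z - z') = inner ℝ (y - z) (z - z') - inner ℝ (x - z) (z - z') := by
      rw [← inner_sub_left, sub_sub_sub_cancel_right]
    have e4 : inner ℝ (y - x) (z - z') ≤ ‖y - x‖ * (C₄ * ε) := by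
      refine (real_inner_le_norm _ _).trans ?_
      rw [dist_eq_norm] at hz
      gcongr
    have e5 : Metric.infDist z M ^ 2 ≤ ‖x - z‖ ^ 2 := by
      have h := Metric.infDist_le_dist_of_mem (x := z) hx
      rw [dist_comm, dist_eq_norm] at h
      have h0 := Metric.infDist_nonneg (x := z) (s := M)
      gcongr
    linarith
  let p : Set 𝔼 → Prop := fun s => ∃ C > 0, ∃ η > 0, ∀ ε, 0 < ε → ε ≤ η →
    ∀ z, dist z z' ≤ C₄ * ε → ∀ y ∈ s, y ∈ M →
      ‖y - z‖ ^ 2 ≤ Metric.infDist z M ^ 2 + Q * ε ^ 2 → ∃ x ∈ proj M z', dist y x < C * ε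
  have hp : p M := by
    refine hM.induction_on (p := p) ⟨1, one_pos, 1, one_pos, by simp⟩ ?_ ?_ ?_
    · rintro s t hst ⟨C, hC, η, hη, h⟩
      exact ⟨C, hC, η, hη, fun ε hε hεη z hz y hy => h ε hε hεη z hz y (hst hy)⟩
    · rintro s t ⟨C, hC, η, hη, h⟩ ⟨C', hC', η', hη', h'⟩
      refine ⟨max C C', by positivity, min η η', by positivity,
        fun ε hε hεη z hz y hy hyM hyz => ?_⟩
      rcases hy with hy | hy
      · obtain ⟨x, hx, hyx⟩ := h ε hε (hεη.trans (min_le_left _ _)) z hz y hy hyM hyz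
        exact ⟨x, hx, hyx.trans_le (by gcongr; exact le_max_left _ _)⟩
      · obtain ⟨x, hx, hyx⟩ := h' ε hε (hεη.trans (min_le_right _ _)) z hz y hy hyM hyz
        exact ⟨x, hx, hyx.trans_le (by gcongr; exact le_max_right _ _)⟩
    · intro y₀ hy₀
      by_cases hy₀z : y₀ ∈ proj M z'
      · obtain ⟨ρ, hρ, α, hα, hball⟩ := h3 z' hz' y₀ hy₀z
        refine ⟨Metric.ball y₀ ρ, mem_nhdsWithin_of_mem_nhds (Metric.ball_mem_nhds y₀ hρ),
          (2 * C₄ + Q) / α + 1, by positivity, 1, one_pos, ?_⟩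
        intro ε hε _ z hz y hy hyM hyz
        refine ⟨y₀, hy₀z, ?_⟩
        have h1 := key y₀ hy₀ y z ε hz hyz
        have h2 := hball y ⟨hyM, hy⟩
        rw [dist_eq_norm]
        -- If `‖y - y₀‖` exceeded the bound, it would also exceed `ε`, so `Q ε² ≤ Q ε ‖y - y₀‖`.
        by_contra! hcon
        have h4 : ε ≤ ‖y - y₀‖ := by
          refine le_trans ?_ hcon
          exact le_mul_of_one_le_left hε.le (le_add_of_nonneg_left (by positivity))
        have h5 : (2 * C₄ + Q) * ε < α * ‖y - y₀‖ := by
          have := mul_le_mul_of_nonneg_left hcon hα.le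
          have e : α * (((2 * C₄ + Q) / α + 1) * ε) = (2 * C₄ + Q) * ε + α * ε := by
            field_simp
          nlinarith [mul_pos hα hε]
        have h6 : 0 < ‖y - y₀‖ := hε.trans_le h4
        have h7 := mul_lt_mul_of_pos_right h5 h6
        have h8 : Q * ε ^ 2 ≤ Q * ε * ‖y - y₀‖ := by
          rw [pow_two, ← mul_assoc]
          gcongr
        nlinarith
      · obtain ⟨x, hx⟩ := hz'.2.1
        have hlt : ‖x - z'‖ ^ 2 < ‖y₀ - z'‖ ^ 2 := by
          have h1 := (Metric.infDist_le_dist_of_mem (x := z') hy₀).lt_of_ne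
            fun h => hy₀z ⟨hy₀, h⟩
          rw [hx.2, dist_comm, dist_eq_norm, dist_comm, dist_eq_norm] at h1
          gcongr
        set g := (‖y₀ - z'‖ ^ 2 - ‖x - z'‖ ^ 2) / 2 with hg
        have hg0 : 0 < g := by linarith
        set b := ‖y₀ - x‖ + 1 with hb
        have hb0 : 0 < b := by positivity
        refine ⟨{y | g < ‖y - z'‖ ^ 2 - ‖x - z'‖ ^ 2} ∩ {y | ‖y - x‖ < b},
          mem_nhdsWithin_of_mem_nhds (Filter.inter_mem
            ((isOpen_lt continuous_const (by fun_prop)).mem_nhds ?_)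
            ((isOpen_lt (by fun_prop) continuous_const).mem_nhds ?_)),
          1, one_pos, min 1 (g / (2 * (b * C₄) + Q + 1)), by positivity, ?_⟩
        · show g < _
          linarith
        · show ‖y₀ - x‖ < b
          linarith
        · rintro ε hε hεη z hz y ⟨hy1, hy2⟩ - hyz
          have h1 := key x hx.1 y z ε hz hyz
          have hε1 : ε ≤ 1 := hεη.trans (min_le_left _ _)
          have hε2 := hεη.trans (min_le_right _ _)
          rw [le_div_iff₀ (by positivity)] at hε2
          have h2 : ‖y - x‖ * (C₄ * ε) ≤ b * (C₄ * ε) := by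
            have : ‖y - x‖ ≤ b := le_of_lt hy2
            gcongr
          have h4 : Q * ε ^ 2 ≤ Q * ε := by
            gcongr
            nlinarith
          have h5 : g < ‖y - z'‖ ^ 2 - ‖x - z'‖ ^ 2 := hy1
          exfalso
          linarith
  obtain ⟨C, hC, η, hη, h⟩ := hp
  exact ⟨C, hC, η, hη, fun ε hε hεη z hz y hy => h ε hε hεη z hz y hy hy⟩

theorem exists_uniform_constants {ι : Type*} {s : Set ι} (hs : s.Finite) {p : ι → ℝ → ℝ → Prop}
    (h : ∀ i ∈ s, ∃ C > 0, ∃ η > 0, p i C η)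
    (hmono : ∀ i C C' η η', C ≤ C' → 0 < η' → η' ≤ η → p i C η → p i C' η') :
    ∃ C > 0, ∃ η > 0, ∀ i ∈ s, p i C η := by
  induction s, hs using Set.Finite.induction_on with
  | empty => exact ⟨1, one_pos, 1, one_pos, by simp⟩
  | @insert a t _ _ ih =>
    obtain ⟨C, hC, η, hη, hp⟩ := ih fun i hi => h i (Set.mem_insert_of_mem _ hi)
    obtain ⟨C', hC', η', hη', hp'⟩ := h a (Set.mem_insert _ _)
    refine ⟨max C C', by positivity, min η η', by positivity, ?_⟩
    rintro i (rfl | hi)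
    · exact hmono _ _ _ _ _ (le_max_right _ _) (by positivity) (min_le_right _ _) hp'
    · exact hmono _ _ _ _ _ (le_max_left _ _) (by positivity) (min_le_left _ _) (hp i hi)

/-- The dichotomy distinguishes whether `d_M(z) < 1 / (4K)`: if so, `d_M(z) = O(ε²)`, and
otherwise the point `w` near `z` with `2z - w` in the closed convex hull of `π_M(w)` is
`O(ε)`-critical. The cases exclude each other since projections are unique near `M`, where the
generalized gradient thus has norm one. -/
theorem exists_isStabilityConstants {m : ℕ} {M : Set 𝔼} (hM : IsCompact M)
    (hC : IsC2Submanifold m M) (h2 : P2 M) (h3 : P3 M) (h4 : P4 M) :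
    ∃ C₁ C₂ C₃ C₄ C₅ ε₀ : ℝ, IsStabilityConstants M C₁ C₂ C₃ C₄ C₅ ε₀ ∧ 1 ≤ C₅ := by
  obtain ⟨K, hK, hKM⟩ := exists_normalQuadraticBound hM hC
  obtain ⟨C, hC0, μ₀, hμ₀, -, h4⟩ := h4
  -- With `d_M ≤ diam M`, this `B` satisfies `d_A² ≤ d_M² + B² ε²` at critical points of `A`.
  set B := √((1 + 2 * K * Metric.diam M) * 4) with hB
  have hdiam : 0 ≤ Metric.diam M := Metric.diam_nonneg
  have hB2 : B ^ 2 = (1 + 2 * K * Metric.diam M) * 4 := Real.sq_sqrt (by positivity)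
  have hB0 : 0 < B := Real.sqrt_pos.2 (by positivity)
  have hsample : ∀ (ε : ℝ) (A : Set 𝔼), 0 < ε → A ⊆ M →
      Metric.hausdorffEDist A M ≤ ENNReal.ofReal ε → ∀ z ∈ criticalPoints A,
      Metric.infDist z A ^ 2 ≤ Metric.infDist z M ^ 2 + B ^ 2 * ε ^ 2 := by
    intro ε A hε hAM hH z hz
    have hne : M.Nonempty := (hz.2.1.mono fun _ h => h.1).mono hAM
    refine (hKM.infDist_sq_le hK.le hM hne hε hAM hH z).trans ?_
    have := infDist_le_diam_of_mem_criticalPoints hM hAM hz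
    rw [hB2, mul_assoc _ 4, mul_pow]
    norm_num
    gcongr
  -- `C₃ = 2B / (1 / (4K))` bounds `2‖w - z‖ / (d_M(w) ε)` when `d_M(w) ≥ 1 / (4K)`.
  set C₃ := 8 * K * B with hC₃
  have hC₃0 : 0 < C₃ := by positivity
  set C₄ := B + C * C₃ with hC₄
  have hC₄0 : 0 < C₄ := by positivity
  obtain ⟨C₅, hC₅, η, hη, hproj⟩ := exists_uniform_constants h2
    (fun z' hz' => h3.exists_dist_lt hM hz' hC₄0.le (sq_nonneg B)) (by
      intro z' C C' η η' hCC _ hηη h ε hε hεη z hz y hy hyz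
      obtain ⟨x, hx, hyx⟩ := h ε hε (hεη.trans hηη) z hz y hy hyz
      exact ⟨x, hx, hyx.trans_le (by gcongr)⟩)
  set ε₀ := min (min (1 / (10 * K * B)) (μ₀ / (2 * C₃))) η
  have hε₀ : 0 < ε₀ := by positivity
  have hε₁ : ∀ ε ≤ ε₀, K * B * ε ≤ 1 / 10 := by
    intro ε hε
    have := hε.trans ((min_le_left _ _).trans (min_le_left _ _))
    rw [le_div_iff₀ (by positivity)] at this
    linarith
  have hε₂ : ∀ ε ≤ ε₀, C₃ * ε < μ₀ := by
    intro ε hε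
    have := hε.trans ((min_le_left _ _).trans (min_le_right _ _))
    rw [le_div_iff₀ (by positivity)] at this
    linarith
  have hnear : ∀ ε : ℝ, 0 < ε → ε ≤ ε₀ → ∀ z : 𝔼,
      (∃ w ∈ muCriticalPoints M (C₃ * ε), dist z w ≤ B * ε) →
        ∃ z' ∈ criticalPoints M, dist z z' ≤ C₄ * ε := by
    rintro ε hε hεε z ⟨w, hw, hzw⟩
    obtain ⟨z', hz', hwz⟩ := h4 (C₃ * ε) (by positivity) (hε₂ ε hεε) w hw
    refine ⟨z', hz', (dist_triangle z w z').trans ?_⟩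
    rw [hC₄]
    linarith
  -- The maximum ensures `1 ≤ C₅`, which makes `δ ≤ C₅ ε` in the packing bound.
  refine ⟨20 * K * B ^ 2, B, C₃, C₄, max C₅ 1, ε₀,
    ⟨by positivity, hB0, hC₃0, hC₄0, by positivity, hε₀, ?_, ?_, ?_⟩, le_max_right _ _⟩
  · intro ε A hε hεε hAM hH z hz
    have hzA := hsample ε A hε hAM hH z hz
    have hne : M.Nonempty := (hz.2.1.mono fun _ h => h.1).mono hAM
    have hKBε := hε₁ ε hεε
    have hKBε0 : 0 < K * B * ε := by positivity
    rw [xor_iff_or_and_not_and]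
    constructor
    · by_cases hzM : K * Metric.infDist z M < 1 / 4
      · exact Or.inl
          (hKM.infDist_le_of_infDist_lt hK hM hB0.le hε hKBε hAM hz hzA hzM)
      · right
        obtain ⟨w, hwz, hzw, hmem⟩ :=
          exists_near_of_mem_criticalPoints hM hB0.le hε hAM hz hzA
        rw [not_lt] at hzM
        have hw4 : 1 / 4 ≤ K * Metric.infDist w M := hzM.trans (by gcongr)
        have hw0 : 0 < Metric.infDist w M := by
          by_contra! h
          nlinarith
        have hwM : w ∉ M := fun h => hw0.ne' (Metric.infDist_zero_of_mem h)
        have hpn := proj_nonempty hM hne w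
        refine ⟨w, ⟨hwM, hpn, (norm_gradDist_le hwM hpn hmem).trans ?_⟩, ?_⟩
        · rw [norm_sub_two_smul_sub, div_le_iff₀ hw0, hC₃]
          nlinarith [mul_pos hB0 hε]
        · rwa [dist_comm, dist_eq_norm]
    · rintro ⟨ha, w, hw, hzw⟩
      have h1 : Metric.infDist w M ≤ Metric.infDist z M + dist w z :=
        Metric.infDist_le_infDist_add_dist
      rw [dist_comm] at h1
      have h5 : (proj M w).Subsingleton := by
        refine hKM.proj_subsingleton ?_
        have e1 : K * Metric.infDist w M ≤ K * (20 * K * B ^ 2 * ε ^ 2 + B * ε) := by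
          gcongr
          linarith
        have e2 : K * (20 * K * B ^ 2 * ε ^ 2 + B * ε)
            = 20 * (K * B * ε) ^ 2 + K * B * ε := by ring
        nlinarith
      obtain ⟨x, hx⟩ := hw.2.1
      have h6 := norm_gradDist_of_proj_eq_singleton hw.1 (h5.eq_singleton_of_mem hx)
      have h7 := hw.2.2
      rw [h6, hC₃] at h7
      linarith
  · intro _ ε A hε hεε _ _ z _ hw
    exact hnear ε hε hεε z hw
  · intro _ _ _ _ ε A hε hεε hAM hH z hz hw
    obtain ⟨z', hz', hd⟩ := hnear ε hε hεε z hw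
    refine ⟨z', hz', hd, fun y hy => ?_⟩
    have hzA := hsample ε A hε hAM hH z hz
    rw [← dist_eq_of_mem_proj hy, dist_eq_norm] at hzA
    obtain ⟨x, hx, hyx⟩ := hproj z' hz' ε hε (hεε.trans (min_le_right _ _)) z hd y (hAM hy.1) hzA
    exact Metric.mem_thickening_iff.2 ⟨x, hx, hyx.trans_le (by gcongr; exact le_max_left _ _)⟩

end Stability

/-! ### Counting critical points -/

section Counting

variable {D : ℕ}

local notation "𝔼" => EuclideanSpace ℝ (Fin D)

theorem P1.finite_proj {M : Set 𝔼} (h1 : P1 M) {z : 𝔼} (hz : z ∈ criticalPoints M) :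
    (proj M z).Finite :=
  Set.finite_coe_iff.1 (finite_of_fin_dim_affineIndependent ℝ (h1 z hz).1)

theorem ncard_inter_ball_le_packingNumber {M A : Set 𝔼} (hM : IsCompact M) {δ : ℝ} (hδ : 0 < δ)
    {ε : ℝ≥0∞} (hA : IsSampling δ ε M A) {x : 𝔼} (hx : x ∈ M) (r : ℝ) :
    (A ∩ Metric.ball x r).ncard ≤ packingNumber M δ r :=
  le_csSup (bddAbove_packingCards hM hδ r) ⟨x, hx, A ∩ Metric.ball x r,
    ⟨hA.1.subset Set.inter_subset_left, fun _ ha => ⟨ha.2, hA.2.1 ha.1⟩, le_top,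
      fun a ha b hb => hA.2.2.2 a ha.1 b hb.1⟩, rfl⟩

theorem ncard_inter_thickening_le {M A : Set 𝔼} (hM : IsCompact M) {δ : ℝ} (hδ : 0 < δ)
    {ε : ℝ≥0∞} (hA : IsSampling δ ε M A) {F : Set 𝔼} (hF : F.Finite) (hFM : F ⊆ M) (r : ℝ) :
    (A ∩ Metric.thickening r F).ncard ≤ packingNumber M δ r * F.ncard := by
  have h1 : A ∩ Metric.thickening r F = ⋃ x ∈ hF.toFinset, A ∩ Metric.ball x r := by
    rw [Metric.thickening_eq_biUnion_ball, Set.inter_iUnion₂]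
    simp
  rw [h1, Set.ncard_eq_toFinset_card F hF, mul_comm]
  refine (Finset.set_ncard_biUnion_le _ _).trans ?_
  refine Finset.sum_le_card_nsmul _ _ _ fun x hx => ?_
  exact ncard_inter_ball_le_packingNumber hM hδ hA (hFM (hF.mem_toFinset.1 hx)) r

/-- A critical point is determined by its projections, so there are at most as many critical
points with projections in `F` as subsets of `F`. -/
theorem ncard_le_two_pow_of_proj_subset {A Z F : Set 𝔼} (hF : F.Finite)
    (hZ : Z ⊆ criticalPoints A) (hZF : ∀ z ∈ Z, proj A z ⊆ F) :
    Z.Finite ∧ Z.ncard ≤ 2 ^ F.ncard := by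
  have hinj : Set.InjOn (proj A) Z := by
    intro z hz z' hz' h
    rw [eq_enclosingCenter_of_mem_criticalPoints (hZ hz), h,
      ← eq_enclosingCenter_of_mem_criticalPoints (hZ hz')]
  have hmaps : Set.MapsTo (proj A) Z (𝒫 F) := hZF
  refine ⟨Set.Finite.of_injOn hmaps hinj hF.finite_subsets, ?_⟩
  rw [← Set.ncard_powerset F hF]
  exact Set.ncard_le_ncard_of_injOn _ hmaps hinj hF.finite_subsets

/-- Critical points of `M` are isolated, and stay away from `M`. -/
theorem P2.exists_separation {M : Set 𝔼} (h2 : P2 M) :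
    ∃ η > 0, ∀ z ∈ criticalPoints M, η ≤ Metric.infDist z M ∧
      ∀ z' ∈ criticalPoints M, z' ≠ z → η ≤ dist z' z := by
  let p : 𝔼 → ℝ → ℝ → Prop := fun z _ η =>
    η ≤ Metric.infDist z M ∧ ∀ z' ∈ criticalPoints M, z' ≠ z → η ≤ dist z' z
  have hp : ∀ z ∈ criticalPoints M, ∃ C > 0, ∃ η > 0, p z C η := by
    intro z hz
    have hfin : (criticalPoints M \ {z}).Finite := h2.subset Set.sdiff_subset
    obtain ⟨ρ, hρ, hball⟩ := Metric.isOpen_iff.1 hfin.isClosed.isOpen_compl z (by simp)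
    have hpos := infDist_pos_of_proj_nonempty hz.1 hz.2.1
    refine ⟨1, one_pos, min ρ (Metric.infDist z M), by positivity, min_le_right _ _,
      fun z' hz' hne => (min_le_left _ _).trans ?_⟩
    by_contra! h
    exact hball (Metric.mem_ball.2 h) ⟨hz', hne⟩
  obtain ⟨C, -, η, hη, h⟩ := exists_uniform_constants h2 hp fun z _ _ _ _ _ _ hηη h =>
    ⟨hηη.trans h.1, fun z' hz' hne => hηη.trans (h.2 z' hz' hne)⟩
  exact ⟨η, hη, h⟩

theorem exists_ncard_criticalPoints_le {M : Set 𝔼} (hM : IsCompact M) (h1 : P1 M) (h2 : P2 M)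
    (h3 : P3 M) (h4 : P4 M) {C₁ C₂ C₃ C₄ C₅ ε₀ : ℝ}
    (hS : IsStabilityConstants M C₁ C₂ C₃ C₄ C₅ ε₀) :
    ∃ ε₁ : ℝ, 0 < ε₁ ∧ ∀ δ ε : ℝ, 0 < δ → δ ≤ ε → ε ≤ ε₁ → ∀ A : Set 𝔼,
      IsSampling δ (ENNReal.ofReal ε) M A → ∀ z ∈ criticalPoints M,
        {w | w ∈ criticalPoints A ∧ dist w z < C₄ * ε}.Finite ∧
        {w | w ∈ criticalPoints A ∧ dist w z < C₄ * ε}.ncard ≤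
          2 ^ (packingNumber M δ (C₅ * ε) * (proj M z).ncard) := by
  obtain ⟨η, hη, hsep⟩ := h2.exists_separation
  have hp1 := hS.pos₁
  have hp4 := hS.pos₄
  have hp0 := hS.pos_ε₀
  refine ⟨min (min ε₀ 1) (min (η / (4 * C₁)) (η / (4 * C₄))), by positivity, ?_⟩
  intro δ ε hδ hδε hεε A hA z hz
  have hε : 0 < ε := hδ.trans_le hδε
  have hε₀ : ε ≤ ε₀ := hεε.trans ((min_le_left _ _).trans (min_le_left _ _))
  have hε1 : ε ≤ 1 := hεε.trans ((min_le_left _ _).trans (min_le_right _ _))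
  have hεC₁ := hεε.trans ((min_le_right _ _).trans (min_le_left _ _))
  have hεC₄ := hεε.trans ((min_le_right _ _).trans (min_le_right _ _))
  rw [le_div_iff₀ (by positivity)] at hεC₁ hεC₄
  have hfin := h1.finite_proj hz
  have hAF : (A ∩ Metric.thickening (C₅ * ε) (proj M z)).Finite :=
    hA.1.subset Set.inter_subset_left
  have hcount := ncard_le_two_pow_of_proj_subset (A := A)
    (Z := {w | w ∈ criticalPoints A ∧ dist w z < C₄ * ε}) hAF (fun w hw => hw.1) ?_
  · refine ⟨hcount.1, hcount.2.trans (Nat.pow_le_pow_right two_pos ?_)⟩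
    exact ncard_inter_thickening_le hM hδ hA hfin (fun x hx => hx.1) _
  · rintro w ⟨hw, hwz⟩
    obtain ⟨hzM, hzsep⟩ := hsep z hz
    -- `w` is too far from `M` for the first case of the dichotomy.
    have hfar : ¬ Metric.infDist w M ≤ C₁ * ε ^ 2 := by
      intro h
      have e1 : Metric.infDist z M ≤ Metric.infDist w M + dist z w :=
        Metric.infDist_le_infDist_add_dist
      rw [dist_comm] at e1
      have e2 : C₁ * ε ^ 2 ≤ C₁ * ε := by
        gcongr
        nlinarith
      linarith
    have hcase := ((xor_iff_or_and_not_and _ _).1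
      (hS.dichotomy ε A hε hε₀ hA.2.1 hA.2.2.1 w hw)).1.resolve_left hfar
    obtain ⟨z', hz', hwz', hsub⟩ :=
      hS.near_proj h1 h2 h3 h4 ε A hε hε₀ hA.2.1 hA.2.2.1 w hw hcase
    have hzz : z' = z := by
      by_contra hne
      have e1 := hzsep z' hz' hne
      have e2 := dist_triangle_left z' z w
      linarith
    subst hzz
    exact fun y hy => ⟨hy.1, hsub hy⟩

end Counting

end CritDist

theorem corollary1p4 (m : ℕ) :
    ∃ Cm : ℝ, 0 < Cm ∧
      ∀ (D : ℕ) (M : Set (EuclideanSpace ℝ (Fin D))),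
        IsCompact M → CritDist.IsC2Submanifold m M →
        CritDist.P1 M → CritDist.P2 M → CritDist.P3 M → CritDist.P4 M →
        ∃ C₁ C₂ C₃ C₄ C₅ ε₀ : ℝ, CritDist.IsStabilityConstants M C₁ C₂ C₃ C₄ C₅ ε₀ ∧
          ∃ ε₁ : ℝ, 0 < ε₁ ∧
            ∀ δ ε : ℝ, 0 < δ → δ ≤ ε → ε ≤ ε₁ →
              (∀ A : Set (EuclideanSpace ℝ (Fin D)),
                CritDist.IsSampling δ (ENNReal.ofReal ε) M A →
                ∀ z ∈ CritDist.criticalPoints M,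
                  {w | w ∈ CritDist.criticalPoints A ∧ dist w z < C₄ * ε}.Finite ∧
                  {w | w ∈ CritDist.criticalPoints A ∧ dist w z < C₄ * ε}.ncard ≤
                    2 ^ (CritDist.packingNumber M δ (C₅ * ε) * (CritDist.proj M z).ncard)) ∧
              (CritDist.packingNumber M δ (C₅ * ε) : ℝ) ≤ (Cm * C₅ * ε / δ) ^ m := by
  refine ⟨5, by norm_num, fun D M hM hC h1 h2 h3 h4 => ?_⟩
  obtain ⟨C₁, C₂, C₃, C₄, C₅, ε₀, hS, hC₅⟩ :=
    CritDist.exists_isStabilityConstants hM hC h2 h3 h4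
  obtain ⟨ε₁, hε₁, hcount⟩ := CritDist.exists_ncard_criticalPoints_le hM h1 h2 h3 h4 hS
  obtain ⟨r₀, hr₀, hpack⟩ := CritDist.exists_packingNumber_le hM hC
  have hp5 := hS.pos₅
  refine ⟨C₁, C₂, C₃, C₄, C₅, ε₀, hS, min ε₁ (r₀ / C₅), by positivity, ?_⟩
  intro δ ε hδ hδε hε
  refine ⟨hcount δ ε hδ hδε (hε.trans (min_le_left _ _)), ?_⟩
  have hr : C₅ * ε ≤ r₀ := by
    have := hε.trans (min_le_right _ _)
    rw [le_div_iff₀ hp5] at this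
    linarith
  rw [mul_assoc 5]
  exact hpack δ (C₅ * ε) hδ (hδε.trans (le_mul_of_one_le_left (hδ.le.trans hδε) hC₅)) hr
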